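/- Let $\mathcal H$ be a finite-dimensional complex Hilbert space, and let $\|\cdot\|$ be any norm on the space $\mathcal B(\mathcal H)$ of linear operators on $\mathcal H$; the topology it induces is called the natural topology. Let $S_1^+\subset\mathcal B(\mathcal H)$ be the set of density matrices (self-adjoint positive semidefinite operators of trace $1$) and $\mathbf P_{\mathcal H}\subset S_1^+$ the set of pure states, i.e. of the rank-one projectors $P_\psi:\phi\mapsto\langle\psi|\phi\rangle\,\psi$ with $\langle\psi|\psi\rangle=1$. Let $d$ be a distance on $\mathbf P_{\mathcal H}$ which induces the natural topology on $\mathbf P_{\mathcal H}$ and satisfies $d(P,Q)\ge\|P-Q\|$ for all $P,Q\in\mathbf P_{\mathcal H}$. For $p\ge 1$ and Borel (equivalently, Radon) probability measures $\mu,\nu$ on $\mathbf P_{\mathcal H}$ let $$W_p(\mu,\nu)=\Big(\inf_{\pi}\iint d(P,Q)^p\,\mathrm d\pi(P,Q)\Big)^{1/p},$$ the infimum being over the probability measures $\pi$ on $\mathbf P_{\mathcal H}\times\mathbf P_{\mathcal H}$ with marginals $\mu$ and $\nu$. For $\rho\in S_1^+$ let $\mathcal P_\rho$ be the set of the probability measures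 $\mu$ on $\mathbf P_{\mathcal H}$ with $\int P\,\mathrm d\mu(P)=\rho$. For $\rho,\sigma\in S_1^+$ put $$\widehat D_p(\rho,\sigma)=\inf_{\mu\in\mathcal P_\rho}\ \inf_{\nu\in\mathcal P_\sigma}W_p(\mu,\nu),$$ $$D_p(\rho,\sigma)=\inf\Big\{\sum_{n=1}^{N}\widehat D_p(\gamma_n,\gamma_{n+1})\ :\ N\ge 1,\ \gamma_1,\dots,\gamma_{N+1}\in S_1^+,\ \gamma_1=\rho,\ \gamma_{N+1}=\sigma\Big\}.$$ Then, for every real $p\ge1$: (i) $D_p$ is a distance on $S_1^+$ which induces the natural topology on $S_1^+$. In particular, $(S_1^+,D_p)$ is Polish (complete and separable) and compact. (ii) If $(\mathbf P_{\mathcal H},d)$ is geodesic and $p>1$, then $(S_1^+,D_p)$ is geodesic. Here a metric space $(X,\delta)$ is geodesic if for all $x,y\in X$ there is $\gamma:[0,1]\to X$ with $\gamma(0)=x$, $\gamma(1)=y$ and $\delta(\gamma(s),\gamma(t))=|s-t|\,\delta(x,y)$ for all $s,t\in[0,1]$. (iii) $D_p(\rho,\sigma)\ge\|\rho-\sigma\|$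 for all $\rho,\sigma\in S_1^+$. (iv) $D_p(P,Q)\le d(P,Q)$ for all $P,Q\in\mathbf P_{\mathcal H}$. If moreover $d(P,Q)=\|P-Q\|$ for all $P,Q\in\mathbf P_{\mathcal H}$, then $D_p(P,Q)=d(P,Q)$ for all $P,Q\in\mathbf P_{\mathcal H}$. -/

import Mathlib

open MeasureTheory

noncomputable section

namespace FoldedWasserstein

/-! ### Distances -/

/-- `d` is a distance on `X`. Nonnegativity follows from the three axioms. -/
structure IsDistance {X : Type*} (d : X → X → ℝ) : Prop where
  eq_zero_iff : ∀ x y, d x y = 0 ↔ x = y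
  symm : ∀ x y, d x y = d y x
  triangle : ∀ x y z, d x z ≤ d x y + d y z

/-- The metric space `(X, d)`. -/
abbrev IsDistance.toMetricSpace {X : Type*} {d : X → X → ℝ} (hd : IsDistance d) :
    MetricSpace X where
  dist := d
  dist_self x := (hd.eq_zero_iff x x).2 rfl
  dist_comm := hd.symm
  dist_triangle := hd.triangle
  eq_of_dist_eq_zero h := (hd.eq_zero_iff _ _).1 h

/-- The topology induced by the distance `d`. -/
abbrev IsDistance.topology {X : Type*} {d : X → X → ℝ} (hd : IsDistance d) :
    TopologicalSpace X :=
  hd.toMetricSpace.toUniformSpace.toTopologicalSpace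

/-- `(X, d)` is geodesic: any two points are joined by a constant speed path, parametrized by
`[0, 1]`, that realizes their distance. -/
def IsGeodesic {X : Type*} (d : X → X → ℝ) : Prop :=
  ∀ x y : X, ∃ γ : ℝ → X, γ 0 = x ∧ γ 1 = y ∧
    ∀ s ∈ Set.Icc (0 : ℝ) 1, ∀ t ∈ Set.Icc (0 : ℝ) 1, d (γ s) (γ t) = |s - t| * d x y

/-! ### Standard optimal transport -/

section Transport

variable {E : Type*} [MeasurableSpace E]

/-- The couplings of `μ` and `ν`. -/
def couplings (μ ν : ProbabilityMeasure E) : Set (ProbabilityMeasure (E × E)) :=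
  {π | (π : Measure (E × E)).map Prod.fst = μ ∧ (π : Measure (E × E)).map Prod.snd = ν}

/-- The Kantorovich cost `inf_π ∫ c dπ` over the couplings `π` of `μ` and `ν`, for a finite cost
function that is integrable for all couplings (for example continuous on a compact space). -/
def kantorovichCost (c : E → E → ℝ) (μ ν : ProbabilityMeasure E) : ℝ :=
  ⨅ π : couplings μ ν, ∫ z, c z.1 z.2 ∂(π.1 : Measure (E × E))

/-- The Wasserstein distance of order `p` associated with `d`. -/
def wasserstein (d : E → E → ℝ) (p : ℝ) (μ ν : ProbabilityMeasure E) : ℝ :=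
  (kantorovichCost (fun x y => d x y ^ p) μ ν) ^ (1 / p)

end Transport

/-! ### Density matrices and pure states -/

section Quantum

variable {H : Type*} [NormedAddCommGroup H] [InnerProductSpace ℂ H]

variable (H) in
/-- Density matrices: self-adjoint positive semidefinite operators of trace one. -/
def densityMatrices : Set (H →L[ℂ] H) :=
  {ρ | ρ.IsPositive ∧ LinearMap.trace ℂ H (ρ : H →ₗ[ℂ] H) = 1}

variable (H) in
/-- Pure states: the rank-one projectors `P_ψ : φ ↦ ⟨ψ, φ⟩ ψ` with `ψ` a unit vector. -/
def pureStates : Set (H →L[ℂ] H) :=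
  {P | ∃ ψ : H, ‖ψ‖ = 1 ∧ ∀ φ : H, P φ = inner ℂ ψ φ • ψ}

theorem pureStates_subset_densityMatrices [FiniteDimensional ℂ H] :
    pureStates H ⊆ densityMatrices H := by
  rintro P ⟨ψ, hψ, hP⟩
  have h : P = InnerProductSpace.rankOne ℂ ψ ψ := by
    ext φ
    simp [hP]
  subst h
  refine ⟨InnerProductSpace.isPositive_rankOne_self ψ, ?_⟩
  rw [InnerProductSpace.trace_rankOne, inner_self_eq_norm_sq_to_K, hψ]
  simp

/-- A pure state as a density matrix. -/
def toDensity [FiniteDimensional ℂ H] (P : pureStates H) : densityMatrices H :=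
  ⟨P.1, pureStates_subset_densityMatrices P.2⟩

/-- The Borel probability measures on the (compact metrizable) set of pure states with
barycenter `ρ`. -/
def representing (ρ : densityMatrices H) : Set (ProbabilityMeasure (pureStates H)) :=
  {μ | ∫ P, (P : H →L[ℂ] H) ∂(μ : Measure (pureStates H)) = ρ}

/-- The quantum folded Kantorovich semi-distance. -/
def foldedKantorovich (d : pureStates H → pureStates H → ℝ) (p : ℝ)
    (ρ σ : densityMatrices H) : ℝ :=
  ⨅ μ : representing ρ, ⨅ ν : representing σ, wasserstein d p μ.1 ν.1

/-- The quantum folded Wasserstein pseudo-distance: the infimum of the total folded Kantorovich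
cost over finite chains `γ 0 = ρ, γ 1, …, γ N = σ` of density matrices, with `N ≥ 1`. -/
def foldedWasserstein (d : pureStates H → pureStates H → ℝ) (p : ℝ)
    (ρ σ : densityMatrices H) : ℝ :=
  sInf {s | ∃ N : ℕ, 1 ≤ N ∧ ∃ γ : ℕ → densityMatrices H, γ 0 = ρ ∧ γ N = σ ∧
    s = ∑ n ∈ Finset.range N, foldedKantorovich d p (γ n) (γ (n + 1))}

/-! ### The natural topology -/

theorem isDistance_of_norm (N : Seminorm ℂ (H →L[ℂ] H)) (hN : ∀ A, N A = 0 → A = 0) :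
    IsDistance (fun A B => N (A - B)) where
  eq_zero_iff A B := ⟨fun h => sub_eq_zero.1 (hN _ h), fun h => by simp [h]⟩
  symm A B := map_sub_rev N A B
  triangle A B C := by
    have h := map_add_le_add N (A - B) (B - C)
    rwa [sub_add_sub_cancel] at h

/-- The topology on the operators on `H` induced by the norm `N`. -/
abbrev naturalTopology (N : Seminorm ℂ (H →L[ℂ] H)) (hN : ∀ A, N A = 0 → A = 0) :
    TopologicalSpace (H →L[ℂ] H) :=
  (isDistance_of_norm N hN).topology

theorem topology_unique {V : Type*} [NormedAddCommGroup V] [NormedSpace ℂ V]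
    [FiniteDimensional ℂ V] (t : TopologicalSpace V) (g : @IsTopologicalAddGroup V t _)
    (s : @ContinuousSMul ℂ V _ _ t) (h : @T2Space V t) :
    (UniformSpace.toTopologicalSpace : TopologicalSpace V) = t :=
  le_antisymm
    (continuous_id_iff_le.1
      (@LinearMap.continuous_of_finiteDimensional ℂ _ V _ _ UniformSpace.toTopologicalSpace _ _ V _ _ t g s _ _ _
        LinearMap.id))
    (continuous_id_iff_le.1
      (@LinearMap.continuous_of_finiteDimensional ℂ _ V _ _ t g s V _ _ UniformSpace.toTopologicalSpace _ _ _ h _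
        LinearMap.id))

/-- All norms induce the usual topology, whose Borel sets are the measurable sets used above. -/
theorem naturalTopology_eq [FiniteDimensional ℂ H]
    (N : Seminorm ℂ (H →L[ℂ] H)) (hN : ∀ A, N A = 0 → A = 0) :
    naturalTopology N hN = ContinuousLinearMap.topologicalSpace := by
  have h₁ : FiniteDimensional ℂ (H →L[ℂ] H) := inferInstance
  have h₂ : IsTopologicalAddGroup (H →L[ℂ] H) := inferInstance
  have h₃ : ContinuousSMul ℂ (H →L[ℂ] H) := inferInstance
  have h₄ : T2Space (H →L[ℂ] H) := inferInstance
  let g : NormedAddCommGroup (H →L[ℂ] H) :=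
    { (inferInstance : AddCommGroup (H →L[ℂ] H)), (isDistance_of_norm N hN).toMetricSpace with
      norm := fun A => N A
      dist_eq := fun A B => by
        rw [neg_add_eq_sub]
        exact map_sub_rev N A B }
  let v : @NormedSpace ℂ (H →L[ℂ] H) _ g.toSeminormedAddCommGroup :=
    @NormedSpace.mk ℂ (H →L[ℂ] H) _ g.toSeminormedAddCommGroup
      (inferInstance : Module ℂ (H →L[ℂ] H)) (fun a A => (map_smul_eq_mul N a A).le)
  exact @topology_unique _ g v h₁ _ h₂ h₃ h₄

end Quantum

end FoldedWasserstein

end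

/-! Barycenters and cost of a plan on pairs of pure states are means of continuous functions with
values in a finite-dimensional space. By Carathéodory, some finitely supported plan has the same
barycenters and the same cost. So `foldedKantorovich` is an infimum over finite plans
(`exists_finite_plan`, `foldedKantorovich_mixture_le`), and everything reduces to finite sums.

Lower bound: along a finite plan, `N (ρ - σ)` is at most the weighted mean of the `d (P i) (Q i)`,
hence at most their `p`-mean. As `N` obeys the triangle inequality, the bound survives the infimum
over chains, so `foldedWasserstein` separates points. Plans may represent an intermediate state by
different measures, so they cannot simply be glued; chains supply the triangle inequality instead.

Topology: the norm bound gives one inclusion. For the other, every state is a mixture of `dim H`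
pure states, so mixing is a quotient map from a compact space; an explicit coupling
(`foldedKantorovich_mixture_mixture_le`) makes it continuous for the new distance.

Geodesics: moving the atoms of a finite plan along geodesics of `d` turns a link into a Lipschitz
curve. Concatenating the links of nearly optimal chains gives curves with constants close to the
distance, and compactness yields an exact geodesic. -/

open MeasureTheory

namespace FoldedWasserstein

noncomputable section

/-! ### Integrals as finite convex combinations. -/

section ConvexHull

variable {E : Type*} [NormedAddCommGroup E] [NormedSpace ℝ E] [FiniteDimensional ℝ E]

/-- In finite dimension the convex hull of a compact set is compact. -/
theorem isCompact_convexHull {s : Set E} (hs : IsCompact s) : IsCompact (convexHull ℝ s) := by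
  rcases s.eq_empty_or_nonempty with rfl | ⟨x₀, hx₀⟩
  · simp
  -- Carathéodory's bound: a fixed number of points suffices, so the hull is the image of a single
  -- compact set.
  let m := Module.finrank ℝ E + 1
  let F : (Fin m → ℝ) × (Fin m → E) → E := fun q => ∑ i, q.1 i • q.2 i
  have hF : Continuous F := by fun_prop
  have hK : IsCompact (stdSimplex ℝ (Fin m) ×ˢ Set.univ.pi fun _ : Fin m => s) :=
    (isCompact_stdSimplex ℝ (Fin m)).prod (isCompact_univ_pi fun _ => hs)
  convert hK.image hF using 1
  apply Set.Subset.antisymm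
  · intro x hx
    obtain ⟨ι, _, z, w, hz, hai, hw, hw1, rfl⟩ := eq_pos_convex_span_of_mem_convexHull hx
    have hcard : Fintype.card ι ≤ Fintype.card (Fin m) := by
      rw [Fintype.card_fin]
      refine hai.card_le_finrank_succ.trans ?_
      exact Nat.add_le_add_right (Submodule.finrank_le _) 1
    obtain ⟨e⟩ := Function.Embedding.nonempty_of_card_le hcard
    -- Unused slots get weight zero and the dummy point `x₀`, since each slot must hold a point of
    -- `s`.
    refine ⟨(Function.extend e w 0, Function.extend e z fun _ => x₀), ⟨⟨?_, ?_⟩, ?_⟩, ?_⟩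
    · intro j
      by_cases hj : ∃ i, e i = j
      · obtain ⟨i, rfl⟩ := hj
        simpa [e.injective.extend_apply] using (hw i).le
      · simp [Function.extend_apply' _ _ _ hj]
    · rw [← hw1]
      refine (Fintype.sum_of_injective e e.injective w _ ?_ ?_).symm
      · intro j hj
        exact Function.extend_apply' _ _ _ hj
      · intro i
        exact (e.injective.extend_apply _ _ _).symm
    · intro j _
      by_cases hj : ∃ i, e i = j
      · obtain ⟨i, rfl⟩ := hj
        simpa [e.injective.extend_apply] using hz ⟨i, rfl⟩
      · simpa [Function.extend_apply' _ _ _ hj] using hx₀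
    · refine (Fintype.sum_of_injective e e.injective (fun i => w i • z i) _ ?_ ?_).symm
      · intro j hj
        simp [Function.extend_apply' _ _ _ hj]
      · intro i
        simp [e.injective.extend_apply]
  · rintro _ ⟨⟨w, z⟩, ⟨hw, hz⟩, rfl⟩
    exact mem_convexHull_of_exists_fintype w z hw.1 hw.2 (fun i => hz i trivial) rfl

/-- The mean of a continuous function on a compact space is a finite convex combination of its
values. -/
theorem exists_finite_convex_combination_eq_integral {Z : Type*} [TopologicalSpace Z]
    [CompactSpace Z] [MeasurableSpace Z] (π : Measure Z) [IsProbabilityMeasure π]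
    {f : Z → E} (hf : Continuous f) (hfi : Integrable f π) :
    ∃ (ι : Type) (_ : Fintype ι) (w : ι → ℝ) (z : ι → Z), (∀ i, 0 ≤ w i) ∧ ∑ i, w i = 1 ∧
      ∑ i, w i • f (z i) = ∫ x, f x ∂π := by
  have hmem : ∫ x, f x ∂π ∈ convexHull ℝ (Set.range f) :=
    (convex_convexHull ℝ _).integral_mem (isCompact_convexHull (isCompact_range hf)).isClosed
      (Filter.Eventually.of_forall fun x => subset_convexHull ℝ _ ⟨x, rfl⟩) hfi
  obtain ⟨ι, _, w, y, hw, hw1, hy, hsum⟩ := mem_convexHull_iff_exists_fintype.1 hmem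
  choose z hz using hy
  -- Reindexing by `Fin` puts the index type in `Type`, whatever the universe of `E`.
  let e := Fintype.equivFin ι
  refine ⟨Fin (Fintype.card ι), inferInstance, w ∘ e.symm, z ∘ e.symm, fun i => hw _, ?_, ?_⟩
  · rw [← hw1]; exact e.symm.sum_comp w
  · rw [← hsum, ← e.symm.sum_comp fun i => w i • y i]
    simp [hz]

end ConvexHull

/-! ### Lipschitz curves and geodesics in metric spaces. -/

/-- A compact metric space is geodesic if any two points can be joined by curves whose Lipschitz
constants are arbitrarily close to the distance. -/
theorem exists_geodesic_of_approx {S : Type*} [MetricSpace S] [CompactSpace S] (x y : S)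
    (h : ∀ L > dist x y, ∃ γ : ℝ → S, γ 0 = x ∧ γ 1 = y ∧
      ∀ s ∈ Set.Icc (0 : ℝ) 1, ∀ t ∈ Set.Icc (0 : ℝ) 1, dist (γ s) (γ t) ≤ |s - t| * L) :
    ∃ γ : ℝ → S, γ 0 = x ∧ γ 1 = y ∧
      ∀ s ∈ Set.Icc (0 : ℝ) 1, ∀ t ∈ Set.Icc (0 : ℝ) 1,
        dist (γ s) (γ t) = |s - t| * dist x y := by
  let C : ℝ → Set (ℝ → S) := fun L => {γ | γ 0 = x ∧ γ 1 = y ∧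
    ∀ s ∈ Set.Icc (0 : ℝ) 1, ∀ t ∈ Set.Icc (0 : ℝ) 1, dist (γ s) (γ t) ≤ |s - t| * L}
  have hmono : ∀ {L L'}, L ≤ L' → C L ⊆ C L' := fun hL γ hγ =>
    ⟨hγ.1, hγ.2.1, fun s hs t ht => (hγ.2.2 s hs t ht).trans (by gcongr)⟩
  have hclosed : ∀ L, IsClosed (C L) := by
    intro L
    refine (isClosed_eq (continuous_apply 0) continuous_const).and
      ((isClosed_eq (continuous_apply 1) continuous_const).and ?_)
    simp only [Set.ofPred_forall]
    exact isClosed_biInter fun s _ => isClosed_biInter fun t _ =>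
      isClosed_le ((continuous_apply s).dist (continuous_apply t)) continuous_const
  let L : ℕ → ℝ := fun n => dist x y + 1 / ((n : ℝ) + 1)
  -- By Tychonoff `ℝ → S` is compact for pointwise convergence, and the conditions defining `C` are
  -- pointwise closed; no equicontinuity argument is required.
  have hne : (⋂ n, C (L n)).Nonempty := by
    refine IsCompact.nonempty_iInter_of_sequence_nonempty_isCompact_isClosed (fun n => C (L n))
      (fun n => hmono ?_) (fun n => h _ ?_) (hclosed _).isCompact (fun n => hclosed _)
    · have := Nat.one_div_le_one_div (α := ℝ) (Nat.le_succ n)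
      simpa [L] using this
    · have : (0 : ℝ) < 1 / ((n : ℝ) + 1) := by positivity
      simpa [L] using this
  obtain ⟨γ, hγ⟩ := hne
  simp only [Set.mem_iInter] at hγ
  obtain ⟨h0, h1, -⟩ := hγ 0
  have hle : ∀ s ∈ Set.Icc (0 : ℝ) 1, ∀ t ∈ Set.Icc (0 : ℝ) 1,
      dist (γ s) (γ t) ≤ |s - t| * dist x y := by
    intro s hs t ht
    have hlim : Filter.Tendsto (fun n => |s - t| * L n) Filter.atTop
        (nhds (|s - t| * (dist x y + 0))) :=
      (tendsto_const_nhds.add tendsto_one_div_add_atTop_nhds_zero_nat).const_mul _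
    rw [add_zero] at hlim
    exact ge_of_tendsto' hlim fun n => (hγ n).2.2 s hs t ht
  have hge : ∀ s ∈ Set.Icc (0 : ℝ) 1, ∀ t ∈ Set.Icc (0 : ℝ) 1, s ≤ t →
      dist (γ s) (γ t) = |s - t| * dist x y := by
    intro s hs t ht hst
    refine le_antisymm (hle s hs t ht) ?_
    -- The outer pieces have length at most `s * dist x y` and `(1 - t) * dist x y`, so the middle
    -- one must account for the rest.
    have e1 := hle 0 (by simp) s hs
    have e2 := hle t ht 1 (by simp)
    have e3 := dist_triangle4 (γ 0) (γ s) (γ t) (γ 1)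
    rw [zero_sub, abs_neg, abs_of_nonneg hs.1] at e1
    rw [abs_sub_comm, abs_of_nonneg (by linarith [ht.2])] at e2
    rw [abs_sub_comm, abs_of_nonneg (by linarith)]
    rw [h0, h1] at e3
    rw [h0] at e1
    rw [h1] at e2
    linarith
  refine ⟨γ, h0, h1, fun s hs t ht => ?_⟩
  rcases le_total s t with hst | hst
  · exact hge s hs t ht hst
  · rw [dist_comm, abs_sub_comm]
    exact hge t ht s hs hst

/-- Concatenation of Lipschitz curves adds the Lipschitz constants. -/
theorem exists_lipschitz_curve_trans {S : Type*} [MetricSpace S] {x y z : S} {L M : ℝ}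
    (hL : 0 < L) (hM : 0 < M)
    (h₁ : ∃ γ : ℝ → S, γ 0 = x ∧ γ 1 = y ∧
      ∀ s ∈ Set.Icc (0 : ℝ) 1, ∀ t ∈ Set.Icc (0 : ℝ) 1, dist (γ s) (γ t) ≤ |s - t| * L)
    (h₂ : ∃ γ : ℝ → S, γ 0 = y ∧ γ 1 = z ∧
      ∀ s ∈ Set.Icc (0 : ℝ) 1, ∀ t ∈ Set.Icc (0 : ℝ) 1, dist (γ s) (γ t) ≤ |s - t| * M) :
    ∃ γ : ℝ → S, γ 0 = x ∧ γ 1 = z ∧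
      ∀ s ∈ Set.Icc (0 : ℝ) 1, ∀ t ∈ Set.Icc (0 : ℝ) 1,
        dist (γ s) (γ t) ≤ |s - t| * (L + M) := by
  obtain ⟨α, hα0, hα1, hα⟩ := h₁
  obtain ⟨β, hβ0, hβ1, hβ⟩ := h₂
  have hLM : 0 < L + M := by linarith
  -- Splitting time in proportion to the constants gives both pieces the same speed bound `L + M`.
  let a : ℝ := L / (L + M)
  have ha : a * (L + M) = L := div_mul_cancel₀ _ hLM.ne'
  let u : ℝ → ℝ := fun s => s * (L + M) / L
  let v : ℝ → ℝ := fun s => (s * (L + M) - L) / M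
  have hu : ∀ s, u s * L = s * (L + M) := fun s => div_mul_cancel₀ _ hL.ne'
  have hv : ∀ s, v s * M = s * (L + M) - L := fun s => div_mul_cancel₀ _ hM.ne'
  have hu_mem : ∀ s ∈ Set.Icc (0 : ℝ) 1, s ≤ a → u s ∈ Set.Icc (0 : ℝ) 1 := by
    intro s hs hsa
    refine ⟨div_nonneg (mul_nonneg hs.1 hLM.le) hL.le, (div_le_one hL).2 ?_⟩
    exact (mul_le_mul_of_nonneg_right hsa hLM.le).trans ha.le
  have hv_mem : ∀ s ∈ Set.Icc (0 : ℝ) 1, a ≤ s → v s ∈ Set.Icc (0 : ℝ) 1 := by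
    intro s hs hsa
    refine ⟨div_nonneg ?_ hM.le, (div_le_one hM).2 ?_⟩
    · have := mul_le_mul_of_nonneg_right hsa hLM.le
      linarith
    · nlinarith [hs.2]
  let γ : ℝ → S := fun s => if s ≤ a then α (u s) else β (v s)
  have key : ∀ s ∈ Set.Icc (0 : ℝ) 1, ∀ t ∈ Set.Icc (0 : ℝ) 1, s ≤ t →
      dist (γ s) (γ t) ≤ |s - t| * (L + M) := by
    intro s hs t ht hst
    rw [abs_sub_comm, abs_of_nonneg (sub_nonneg.2 hst)]
    by_cases hta : t ≤ a
    · have hsa := hst.trans hta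
      simp only [γ, if_pos hta, if_pos hsa]
      refine (hα _ (hu_mem s hs hsa) _ (hu_mem t ht hta)).trans ?_
      rw [abs_sub_comm, abs_of_nonneg, sub_mul, hu, hu, sub_mul]
      simp only [u, sub_nonneg]; gcongr
    · have hta' := (not_le.1 hta).le
      by_cases hsa : s ≤ a
      · simp only [γ, if_neg hta, if_pos hsa]
        have e1 := hα _ (hu_mem s hs hsa) 1 (by simp)
        have e2 := hβ 0 (by simp) _ (hv_mem t ht hta')
        rw [abs_sub_comm, abs_of_nonneg (sub_nonneg.2 (hu_mem s hs hsa).2), hα1, sub_mul, hu] at e1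
        rw [zero_sub, abs_neg, abs_of_nonneg (hv_mem t ht hta').1, hβ0, hv] at e2
        linarith [dist_triangle (α (u s)) y (β (v t))]
      · have hsa' := (not_le.1 hsa).le
        simp only [γ, if_neg hta, if_neg hsa]
        refine (hβ _ (hv_mem s hs hsa') _ (hv_mem t ht hta')).trans ?_
        rw [abs_sub_comm, abs_of_nonneg, sub_mul, hv, hv]
        · linarith
        · simp only [v, sub_nonneg]; gcongr
  refine ⟨γ, ?_, ?_, fun s hs t ht => ?_⟩
  · have : (0 : ℝ) ≤ a := div_nonneg hL.le hLM.le
    simp [γ, this, u, hα0]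
  · have : ¬ (1 : ℝ) ≤ a := not_le.2 ((div_lt_one hLM).2 (by linarith))
    have hv1 : v 1 = 1 := by
      simp only [v]; rw [div_eq_one_iff_eq hM.ne']; ring
    simp [γ, this, hv1, hβ1]
  · rcases le_total s t with hst | hst
    · exact key s hs t ht hst
    · rw [dist_comm, abs_sub_comm]
      exact key t ht s hs hst

variable {H : Type*} [NormedAddCommGroup H] [InnerProductSpace ℂ H]

/-! ### Pure states and density matrices -/

theorem rankOne_mem_pureStates {ψ : H} (hψ : ‖ψ‖ = 1) :
    InnerProductSpace.rankOne ℂ ψ ψ ∈ pureStates H :=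
  ⟨ψ, hψ, fun φ => by simp⟩

theorem convex_densityMatrices : Convex ℝ (densityMatrices H) := by
  intro ρ hρ σ hσ a b ha hb hab
  refine ⟨?_, ?_⟩
  · have h : ∀ (c : ℝ) (A : H →L[ℂ] H), c • A = (c : ℂ) • A := fun c A => by
      ext; simp
    rw [h, h]
    exact (hρ.1.smul_of_nonneg (by exact_mod_cast ha)).add
      (hσ.1.smul_of_nonneg (by exact_mod_cast hb))
  · have h : ((a • ρ + b • σ : H →L[ℂ] H) : H →ₗ[ℂ] H) =
        (a : ℂ) • (ρ : H →ₗ[ℂ] H) + (b : ℂ) • (σ : H →ₗ[ℂ] H) := by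
      ext; simp
    rw [h, map_add, map_smul, map_smul, hρ.2, hσ.2]
    simpa using (by exact_mod_cast hab : (a : ℂ) + b = 1)

variable {d : pureStates H → pureStates H → ℝ} {p : ℝ}

theorem IsDistance.nonneg {X : Type*} {d : X → X → ℝ} (hd : IsDistance d) (x y : X) :
    0 ≤ d x y := by
  have h := hd.triangle x y x
  rw [(hd.eq_zero_iff x x).2 rfl, hd.symm y x] at h
  linarith

theorem wasserstein_nonneg (hd : IsDistance d) (μ ν : ProbabilityMeasure (pureStates H)) :
    0 ≤ wasserstein d p μ ν :=
  Real.rpow_nonneg (Real.iInf_nonneg fun _ => integral_nonneg fun _ =>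
    Real.rpow_nonneg (hd.nonneg _ _) _) _

theorem foldedKantorovich_nonneg (hd : IsDistance d) (ρ σ : densityMatrices H) :
    0 ≤ foldedKantorovich d p ρ σ :=
  Real.iInf_nonneg fun _ => Real.iInf_nonneg fun _ => wasserstein_nonneg hd _ _

theorem continuous_cost (hdc : Continuous fun z : pureStates H × pureStates H => d z.1 z.2)
    (hp : 1 ≤ p) : Continuous fun z : pureStates H × pureStates H => d z.1 z.2 ^ p :=
  hdc.rpow_const fun _ => Or.inr (by linarith)

theorem integrable_of_continuous {Z E : Type*} [TopologicalSpace Z] [CompactSpace Z]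
    [T2Space Z] [MeasurableSpace Z] [OpensMeasurableSpace Z] [NormedAddCommGroup E]
    [SecondCountableTopology Z] (π : Measure Z) [IsFiniteMeasure π] {f : Z → E}
    (hf : Continuous f) : Integrable f π := by
  rw [← integrableOn_univ]
  exact hf.continuousOn.integrableOn_compact isCompact_univ

variable [FiniteDimensional ℂ H]

theorem isCompact_pureStates : IsCompact (pureStates H) := by
  have : ProperSpace H := FiniteDimensional.proper ℂ H
  have hc : Continuous fun ψ : H => InnerProductSpace.rankOne ℂ ψ ψ := by
    refine continuous_clm_apply.2 fun φ => ?_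
    simp only [InnerProductSpace.rankOne_apply]
    fun_prop
  convert (isCompact_sphere (0 : H) 1).image hc using 1
  ext P
  constructor
  · rintro ⟨ψ, hψ, hP⟩
    refine ⟨ψ, by simpa using hψ, ?_⟩
    ext φ
    simp [hP]
  · rintro ⟨ψ, hψ, rfl⟩
    exact rankOne_mem_pureStates (by simpa using hψ)

instance : CompactSpace (pureStates H) := isCompact_iff_compactSpace.1 isCompact_pureStates

/-- The mixture `∑ wᵢ Pᵢ` of pure states. -/
def mixture {ι : Type*} [Fintype ι] (w : stdSimplex ℝ ι) (P : ι → pureStates H) :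
    densityMatrices H :=
  ⟨∑ i, w.1 i • (P i).1, convex_densityMatrices.sum_mem (fun i _ => w.2.1 i) w.2.2
    fun i _ => pureStates_subset_densityMatrices (P i).2⟩

theorem continuous_mixture {ι : Type*} [Fintype ι] :
    Continuous fun q : stdSimplex ℝ ι × (ι → pureStates H) => mixture q.1 q.2 := by
  refine Continuous.subtype_mk (continuous_finsetSum _ fun i _ => ?_) _
  have h : Continuous fun q : stdSimplex ℝ ι × (ι → pureStates H) => q.1.1 i :=
    (continuous_apply i).comp (continuous_subtype_val.comp continuous_fst)
  exact h.smul
    (continuous_subtype_val.comp ((continuous_apply i).comp continuous_snd))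

/-- Spectral decomposition: every density matrix is a mixture of `dim H` pure states. -/
theorem surjective_mixture :
    Function.Surjective fun q : stdSimplex ℝ (Fin (Module.finrank ℂ H)) ×
      (Fin (Module.finrank ℂ H) → pureStates H) => mixture q.1 q.2 := by
  rintro ⟨ρ, hρ, htr⟩
  have hpos : (ρ : H →ₗ[ℂ] H).IsPositive := (ContinuousLinearMap.isPositive_toLinearMap_iff ρ).2 hρ
  have hsym := hpos.isSymmetric
  let e := hsym.eigenvectorBasis rfl
  refine ⟨(⟨hsym.eigenvalues rfl, fun i => hpos.nonneg_eigenvalues rfl i, ?_⟩,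
    fun i => ⟨_, rankOne_mem_pureStates (e.norm_eq_one i)⟩), ?_⟩
  · rw [hsym.trace_eq_sum_eigenvalues rfl] at htr
    exact Complex.ofReal_eq_one.1 htr
  · apply Subtype.ext
    ext φ
    conv_rhs => rw [← e.sum_repr' φ]
    simp only [mixture, sum_apply, smul_apply, map_sum,
      map_smul, InnerProductSpace.rankOne_apply]
    refine Finset.sum_congr rfl fun i _ => ?_
    have := hsym.apply_eigenvectorBasis rfl i
    rw [ContinuousLinearMap.coe_coe] at this
    rw [this, smul_comm]
    rfl

/-- A continuous image of a simplex times a power of the compact set of pure states. -/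
instance : CompactSpace (densityMatrices H) :=
  surjective_mixture.compactSpace continuous_mixture

/-! ### The folded Kantorovich cost -/

/-- A plan with barycenters `ρ` and `σ` bounds the folded Kantorovich cost. -/
theorem foldedKantorovich_le_of_plan (hd : IsDistance d) (hp : 1 ≤ p)
    {ρ σ : densityMatrices H} (π : ProbabilityMeasure (pureStates H × pureStates H))
    (h₁ : ∫ z, (z.1 : H →L[ℂ] H) ∂(π : Measure (pureStates H × pureStates H)) = ρ)
    (h₂ : ∫ z, (z.2 : H →L[ℂ] H) ∂(π : Measure (pureStates H × pureStates H)) = σ) :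
    foldedKantorovich d p ρ σ ≤
      (∫ z, d z.1 z.2 ^ p ∂(π : Measure (pureStates H × pureStates H))) ^ (1 / p) := by
  let μ : ProbabilityMeasure (pureStates H) := π.map measurable_fst.aemeasurable
  let ν : ProbabilityMeasure (pureStates H) := π.map measurable_snd.aemeasurable
  have hμ : μ ∈ representing ρ := by
    change ∫ P, (P : H →L[ℂ] H) ∂((π : Measure (pureStates H × pureStates H)).map Prod.fst) = ρ
    rw [integral_map measurable_fst.aemeasurable
      continuous_subtype_val.aestronglyMeasurable, h₁]
  have hν : ν ∈ representing σ := by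
    change ∫ P, (P : H →L[ℂ] H) ∂((π : Measure (pureStates H × pureStates H)).map Prod.snd) = σ
    rw [integral_map measurable_snd.aemeasurable
      continuous_subtype_val.aestronglyMeasurable, h₂]
  have hπ : π ∈ couplings μ ν := ⟨rfl, rfl⟩
  have e1 : foldedKantorovich d p ρ σ ≤ wasserstein d p μ ν := by
    refine (ciInf_le ⟨0, ?_⟩ (⟨μ, hμ⟩ : representing ρ)).trans
      (ciInf_le ⟨0, ?_⟩ (⟨ν, hν⟩ : representing σ))
    · rintro _ ⟨_, rfl⟩
      exact Real.iInf_nonneg fun _ => wasserstein_nonneg hd _ _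
    · rintro _ ⟨_, rfl⟩
      exact wasserstein_nonneg hd _ _
  refine e1.trans (Real.rpow_le_rpow ?_ ?_ (by positivity))
  · exact Real.iInf_nonneg fun _ => integral_nonneg fun _ => Real.rpow_nonneg (hd.nonneg _ _) _
  · refine ciInf_le ⟨0, ?_⟩ (⟨π, hπ⟩ : couplings μ ν)
    rintro _ ⟨_, rfl⟩
    exact integral_nonneg fun _ => Real.rpow_nonneg (hd.nonneg _ _) _

/-- The probability measure with weights `w` on a finite type. -/
def weightPMF {ι : Type*} [Fintype ι] (w : stdSimplex ℝ ι) : PMF ι :=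
  PMF.ofFintype (fun i => ENNReal.ofReal (w.1 i)) (by
    rw [← ENNReal.ofReal_sum_of_nonneg fun i _ => w.2.1 i, w.2.2, ENNReal.ofReal_one])

/-- The finitely supported probability measure `∑ wᵢ δ_{zᵢ}`. -/
def discreteMeasure {Z ι : Type*} [MeasurableSpace Z] [Fintype ι]
    (w : stdSimplex ℝ ι) (z : ι → Z) : ProbabilityMeasure Z :=
  letI : MeasurableSpace ι := ⊤
  ⟨(weightPMF w).toMeasure.map z, Measure.isProbabilityMeasure_map
    (Measurable.aemeasurable measurable_from_top)⟩

theorem integral_discreteMeasure {Z ι E : Type*} [MeasurableSpace Z] [Fintype ι]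
    [NormedAddCommGroup E] [NormedSpace ℝ E] [CompleteSpace E] (w : stdSimplex ℝ ι) (z : ι → Z)
    {f : Z → E} (hf : StronglyMeasurable f) :
    ∫ x, f x ∂(discreteMeasure w z : Measure Z) = ∑ i, w.1 i • f (z i) := by
  let _ : MeasurableSpace ι := ⊤
  have hz : Measurable z := measurable_from_top
  change ∫ x, f x ∂((weightPMF w).toMeasure.map z) = _
  rw [integral_map hz.aemeasurable hf.aestronglyMeasurable, PMF.integral_eq_sum]
  refine Finset.sum_congr rfl fun i _ => ?_
  rw [weightPMF, PMF.ofFintype_apply, ENNReal.toReal_ofReal (w.2.1 i)]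

theorem foldedKantorovich_mixture_le (hd : IsDistance d)
    (hdc : Continuous fun z : pureStates H × pureStates H => d z.1 z.2) (hp : 1 ≤ p)
    {ι : Type*} [Fintype ι] (w : stdSimplex ℝ ι) (P Q : ι → pureStates H) :
    foldedKantorovich d p (mixture w P) (mixture w Q) ≤
      (∑ i, w.1 i * d (P i) (Q i) ^ p) ^ (1 / p) := by
  have h := foldedKantorovich_le_of_plan (d := d) hd hp (ρ := mixture w P) (σ := mixture w Q)
    (discreteMeasure w fun i => (P i, Q i))
    (integral_discreteMeasure _ _ (continuous_subtype_val.comp continuous_fst).stronglyMeasurable)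
    (integral_discreteMeasure _ _ (continuous_subtype_val.comp continuous_snd).stronglyMeasurable)
  rw [integral_discreteMeasure _ _ (continuous_cost hdc hp).stronglyMeasurable] at h
  exact h

theorem representing_nonempty (ρ : densityMatrices H) : (representing ρ).Nonempty := by
  obtain ⟨⟨w, P⟩, rfl⟩ := surjective_mixture ρ
  exact ⟨discreteMeasure w P,
    integral_discreteMeasure _ _ continuous_subtype_val.stronglyMeasurable⟩

theorem couplings_nonempty {E : Type*} [MeasurableSpace E] (μ ν : ProbabilityMeasure E) :
    (couplings μ ν).Nonempty :=
  ⟨μ.prod ν, by simp [Measure.map_fst_prod], by simp [Measure.map_snd_prod]⟩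

/-- Up to an arbitrarily small error, the folded Kantorovich cost is realized by a finitely
supported plan. -/
theorem exists_finite_plan (hd : IsDistance d)
    (hdc : Continuous fun z : pureStates H × pureStates H => d z.1 z.2) (hp : 1 ≤ p)
    {ρ σ : densityMatrices H} {L : ℝ} (hL : foldedKantorovich d p ρ σ < L) :
    ∃ (ι : Type) (_ : Fintype ι) (w : stdSimplex ℝ ι) (P Q : ι → pureStates H),
      mixture w P = ρ ∧ mixture w Q = σ ∧ (∑ i, w.1 i * d (P i) (Q i) ^ p) ^ (1 / p) < L := by
  have := (representing_nonempty ρ).to_subtype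
  have := (representing_nonempty σ).to_subtype
  obtain ⟨⟨μ, hμ⟩, h₁⟩ := exists_lt_of_ciInf_lt hL
  obtain ⟨⟨ν, hν⟩, h₂⟩ := exists_lt_of_ciInf_lt h₁
  have := (couplings_nonempty μ ν).to_subtype
  have hp0 : 0 < p := by linarith
  have hL0 : 0 < L := (foldedKantorovich_nonneg hd ρ σ).trans_lt hL
  have hroot : ∀ {x : ℝ}, 0 ≤ x → (x ^ (1 / p) < L ↔ x < L ^ p) := fun {x} hx => by
    rw [one_div, Real.rpow_inv_lt_iff_of_pos hx hL0.le hp0]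
  have h₃ : kantorovichCost (fun x y => d x y ^ p) μ ν < L ^ p :=
    (hroot (Real.iInf_nonneg fun _ => integral_nonneg fun _ =>
      Real.rpow_nonneg (hd.nonneg _ _) _)).1 h₂
  obtain ⟨⟨π, hπ₁, hπ₂⟩, h₄⟩ := exists_lt_of_ciInf_lt h₃
  -- Both barycenters and the cost form one vector, so a single convex combination reproduces all
  -- three.
  let f : pureStates H × pureStates H → ((H →L[ℂ] H) × (H →L[ℂ] H)) × ℝ :=
    fun z => ((z.1.1, z.2.1), d z.1 z.2 ^ p)
  have c₁ : Continuous fun z : pureStates H × pureStates H => z.1.1 :=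
    continuous_subtype_val.comp continuous_fst
  have c₂ : Continuous fun z : pureStates H × pureStates H => z.2.1 :=
    continuous_subtype_val.comp continuous_snd
  have c₃ := continuous_cost hdc hp
  have hf : Continuous f := (c₁.prodMk c₂).prodMk c₃
  obtain ⟨ι, _, w, z, hw, hw1, hsum⟩ := exists_finite_convex_combination_eq_integral
    (π : Measure (pureStates H × pureStates H)) hf (integrable_of_continuous _ hf)
  rw [integral_pair (integrable_of_continuous _ (c₁.prodMk c₂)) (integrable_of_continuous _ c₃),
    integral_pair (integrable_of_continuous _ c₁) (integrable_of_continuous _ c₂)] at hsum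
  have s₁ := congrArg (fun q => q.1.1) hsum
  have s₂ := congrArg (fun q => q.1.2) hsum
  have s₃ := congrArg (fun q => q.2) hsum
  simp only [f, Prod.fst_sum, Prod.snd_sum, Prod.smul_fst, Prod.smul_snd, smul_eq_mul]
    at s₁ s₂ s₃
  refine ⟨ι, inferInstance, ⟨w, hw, hw1⟩, fun i => (z i).1, fun i => (z i).2, ?_, ?_, ?_⟩
  · apply Subtype.ext
    refine s₁.trans (Eq.trans ?_ hμ)
    rw [← hπ₁, integral_map measurable_fst.aemeasurable
      continuous_subtype_val.aestronglyMeasurable]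
  · apply Subtype.ext
    refine s₂.trans (Eq.trans ?_ hν)
    rw [← hπ₂, integral_map measurable_snd.aemeasurable
      continuous_subtype_val.aestronglyMeasurable]
  · rw [hroot (Finset.sum_nonneg fun i _ => mul_nonneg (hw i)
      (Real.rpow_nonneg (hd.nonneg _ _) _))]
    exact s₃.trans_lt h₄

theorem foldedKantorovich_comm_le (hd : IsDistance d)
    (hdc : Continuous fun z : pureStates H × pureStates H => d z.1 z.2) (hp : 1 ≤ p)
    (ρ σ : densityMatrices H) : foldedKantorovich d p σ ρ ≤ foldedKantorovich d p ρ σ := by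
  refine le_of_forall_gt_imp_ge_of_dense fun L hL => ?_
  obtain ⟨ι, _, w, P, Q, rfl, rfl, h⟩ := exists_finite_plan hd hdc hp hL
  refine (foldedKantorovich_mixture_le hd hdc hp w Q P).trans (Eq.trans_le ?_ h.le)
  simp_rw [hd.symm]

theorem foldedKantorovich_comm (hd : IsDistance d)
    (hdc : Continuous fun z : pureStates H × pureStates H => d z.1 z.2) (hp : 1 ≤ p)
    (ρ σ : densityMatrices H) : foldedKantorovich d p ρ σ = foldedKantorovich d p σ ρ :=
  le_antisymm (foldedKantorovich_comm_le hd hdc hp σ ρ) (foldedKantorovich_comm_le hd hdc hp ρ σ)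

theorem foldedKantorovich_self (hd : IsDistance d)
    (hdc : Continuous fun z : pureStates H × pureStates H => d z.1 z.2) (hp : 1 ≤ p)
    (ρ : densityMatrices H) : foldedKantorovich d p ρ ρ = 0 := by
  refine le_antisymm ?_ (foldedKantorovich_nonneg hd ρ ρ)
  obtain ⟨⟨w, P⟩, rfl⟩ := surjective_mixture ρ
  refine (foldedKantorovich_mixture_le hd hdc hp w P P).trans_eq ?_
  have h0 : ∀ P, d P P = 0 := fun P => (hd.eq_zero_iff P P).2 rfl
  have hp0 : p ≠ 0 := by linarith
  simp [h0, Real.zero_rpow, hp0]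

theorem foldedKantorovich_toDensity_le (hd : IsDistance d)
    (hdc : Continuous fun z : pureStates H × pureStates H => d z.1 z.2) (hp : 1 ≤ p)
    (P Q : pureStates H) : foldedKantorovich d p (toDensity P) (toDensity Q) ≤ d P Q := by
  let w : stdSimplex ℝ Unit := ⟨fun _ => 1, fun _ => zero_le_one, by simp⟩
  have hw : ∀ P : pureStates H, mixture w (fun _ => P) = toDensity P := fun P =>
    Subtype.ext (by simp [mixture, toDensity, w])
  have h := foldedKantorovich_mixture_le hd hdc hp w (fun _ => P) (fun _ => Q)
  rw [hw, hw] at h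
  refine h.trans_eq ?_
  have hp0 : p ≠ 0 := by linarith
  simp [w, Real.rpow_rpow_inv (hd.nonneg P Q) hp0]

/-- The difference of the barycenters is the weighted mean of the `P i - Q i`; the triangle
inequality for `N` and the power mean inequality do the rest. -/
theorem norm_sub_le_foldedKantorovich (N : Seminorm ℂ (H →L[ℂ] H)) (hd : IsDistance d)
    (hdc : Continuous fun z : pureStates H × pureStates H => d z.1 z.2)
    (hd_norm : ∀ P Q : pureStates H, N (P.1 - Q.1) ≤ d P Q) (hp : 1 ≤ p)
    (ρ σ : densityMatrices H) : N (ρ.1 - σ.1) ≤ foldedKantorovich d p ρ σ := by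
  refine le_of_forall_gt_imp_ge_of_dense fun L hL => ?_
  obtain ⟨ι, _, w, P, Q, rfl, rfl, h⟩ := exists_finite_plan hd hdc hp hL
  refine le_trans ?_ ((Real.arith_mean_le_rpow_mean Finset.univ w.1 (fun i => d (P i) (Q i))
    (fun i _ => w.2.1 i) w.2.2 (fun i _ => hd.nonneg _ _) hp).trans h.le)
  have e : (mixture w P).1 - (mixture w Q).1 = ∑ i, w.1 i • ((P i).1 - (Q i).1) := by
    simp [mixture, smul_sub]
  rw [e]
  refine (Finset.le_sum_of_subadditive N (map_zero N).le (map_add_le_add N) _ _).trans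
    (Finset.sum_le_sum fun i _ => ?_)
  rw [← Complex.coe_smul, map_smul_eq_mul, Complex.norm_real, Real.norm_of_nonneg (w.2.1 i)]
  exact mul_le_mul_of_nonneg_left (hd_norm _ _) (w.2.1 i)

/-- Mixtures with close weights and close pure states have a small folded Kantorovich cost. -/
theorem foldedKantorovich_mixture_mixture_le (hd : IsDistance d)
    (hdc : Continuous fun z : pureStates H × pureStates H => d z.1 z.2) (hp : 1 ≤ p)
    {C : ℝ} (hC : ∀ P Q, d P Q ^ p ≤ C) {ι : Type*} [Fintype ι] (w w' : stdSimplex ℝ ι)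
    (P Q : ι → pureStates H) :
    foldedKantorovich d p (mixture w P) (mixture w' Q) ≤
      (∑ i, min (w.1 i) (w'.1 i) * d (P i) (Q i) ^ p +
        (1 - ∑ i, min (w.1 i) (w'.1 i)) * C) ^ (1 / p) := by
  classical
  -- The mass common to both weights stays on the diagonal; the remaining mass `m` is coupled by the
  -- normalized product of the two residuals and costs at most `C` per unit.
  let a : ι → ℝ := fun i => min (w.1 i) (w'.1 i)
  let m : ℝ := 1 - ∑ i, a i
  have ha : ∀ i, 0 ≤ a i := fun i => le_min (w.2.1 i) (w'.2.1 i)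
  have hr : ∀ i, 0 ≤ w.1 i - a i := fun i => sub_nonneg.2 (min_le_left _ _)
  have hr' : ∀ i, 0 ≤ w'.1 i - a i := fun i => sub_nonneg.2 (min_le_right _ _)
  have hrm : ∑ i, (w.1 i - a i) = m := by rw [Finset.sum_sub_distrib, w.2.2]
  have hrm' : ∑ i, (w'.1 i - a i) = m := by rw [Finset.sum_sub_distrib, w'.2.2]
  have hm : 0 ≤ m := hrm ▸ Finset.sum_nonneg fun i _ => hr i
  -- If `m = 0`, division yields `0`, which is right because all residuals then vanish.
  have hdiv : ∀ (v : ι → ℝ), (∀ i, 0 ≤ v i - a i) → ∑ i, (v i - a i) = m →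
      ∀ i, (v i - a i) * m / m = v i - a i := by
    intro v hv hvm i
    rcases hm.eq_or_lt with h0 | h0
    · rw [← h0] at hvm
      rw [(Finset.sum_eq_zero_iff_of_nonneg fun i _ => hv i).1 hvm i (Finset.mem_univ i)]
      simp
    · exact mul_div_cancel_right₀ _ h0.ne'
  let q : ι × ι → ℝ := fun ij => (if ij.1 = ij.2 then a ij.1 else 0) +
    (w.1 ij.1 - a ij.1) * (w'.1 ij.2 - a ij.2) / m
  have hq : ∀ ij, 0 ≤ q ij := fun ij => add_nonneg (by split_ifs <;> simp [ha])
    (div_nonneg (mul_nonneg (hr _) (hr' _)) hm)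
  have hrow : ∀ i, ∑ j, q (i, j) = w.1 i := by
    intro i
    simp only [q, Finset.sum_add_distrib, Finset.sum_ite_eq, Finset.mem_univ, if_true]
    rw [← Finset.sum_div, ← Finset.mul_sum, hrm', hdiv w.1 hr hrm]
    ring
  have hcol : ∀ j, ∑ i, q (i, j) = w'.1 j := by
    intro j
    simp only [q, Finset.sum_add_distrib, Finset.sum_ite_eq', Finset.mem_univ, if_true]
    rw [← Finset.sum_div, ← Finset.sum_mul, hrm, mul_comm, hdiv w'.1 hr' hrm']
    ring
  let W : stdSimplex ℝ (ι × ι) := ⟨q, hq, by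
    rw [Fintype.sum_prod_type]; simp_rw [hrow]; exact w.2.2⟩
  have e₁ : mixture W (fun ij => P ij.1) = mixture w P := by
    apply Subtype.ext
    simp only [mixture, W]
    rw [Fintype.sum_prod_type]
    simp_rw [← Finset.sum_smul, hrow]
  have e₂ : mixture W (fun ij => Q ij.2) = mixture w' Q := by
    apply Subtype.ext
    simp only [mixture, W]
    rw [Fintype.sum_prod_type_right]
    simp_rw [← Finset.sum_smul, hcol]
  have h := foldedKantorovich_mixture_le hd hdc hp W (fun ij => P ij.1) (fun ij => Q ij.2)
  rw [e₁, e₂] at h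
  refine h.trans (Real.rpow_le_rpow (Finset.sum_nonneg fun i _ => mul_nonneg (hq i)
      (Real.rpow_nonneg (hd.nonneg _ _) _)) ?_ (by positivity))
  have hsplit : ∑ ij, W.1 ij * d (P ij.1) (Q ij.2) ^ p = ∑ i, a i * d (P i) (Q i) ^ p +
      ∑ i, ∑ j, (w.1 i - a i) * (w'.1 j - a j) / m * d (P i) (Q j) ^ p := by
    rw [Fintype.sum_prod_type]
    simp only [W, q, add_mul, Finset.sum_add_distrib, ite_mul, zero_mul, Finset.sum_ite_eq,
      Finset.mem_univ, if_true]
  rw [hsplit]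
  refine add_le_add_right ?_ _
  calc ∑ i, ∑ j, (w.1 i - a i) * (w'.1 j - a j) / m * d (P i) (Q j) ^ p
      ≤ ∑ i, ∑ j, (w.1 i - a i) * (w'.1 j - a j) / m * C := by
        refine Finset.sum_le_sum fun i _ => Finset.sum_le_sum fun j _ =>
          mul_le_mul_of_nonneg_left (hC _ _) (div_nonneg (mul_nonneg (hr _) (hr' _)) hm)
    _ = (∑ i, (w.1 i - a i)) * C := by
        rw [Finset.sum_mul]
        refine Finset.sum_congr rfl fun i _ => ?_
        rw [← Finset.sum_mul, ← Finset.sum_div, ← Finset.mul_sum, hrm', hdiv w.1 hr hrm]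
    _ = m * C := by rw [hrm]

end

end FoldedWasserstein

namespace FoldedWasserstein

noncomputable section

/-! ### Infimum over chains -/

section Chain

variable {S : Type*}

/-- The infimum of the total cost over finite chains, for the cost `δ` of a link. -/
def chainInf (δ : S → S → ℝ) (x y : S) : ℝ :=
  sInf {s | ∃ N : ℕ, 1 ≤ N ∧ ∃ γ : ℕ → S, γ 0 = x ∧ γ N = y ∧
    s = ∑ n ∈ Finset.range N, δ (γ n) (γ (n + 1))}

variable {δ : S → S → ℝ}

theorem exists_link_chain (δ : S → S → ℝ) (x y : S) :
    ∃ N : ℕ, 1 ≤ N ∧ ∃ γ : ℕ → S, γ 0 = x ∧ γ N = y ∧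
      δ x y = ∑ n ∈ Finset.range N, δ (γ n) (γ (n + 1)) :=
  ⟨1, le_rfl, fun n => if n = 0 then x else y, by simp, by simp, by simp⟩

theorem chainInf_le (hδ : ∀ x y, 0 ≤ δ x y) {x y : S} {N : ℕ} (hN : 1 ≤ N) {γ : ℕ → S}
    (h0 : γ 0 = x) (h1 : γ N = y) :
    chainInf δ x y ≤ ∑ n ∈ Finset.range N, δ (γ n) (γ (n + 1)) := by
  refine csInf_le ⟨0, ?_⟩ ⟨N, hN, γ, h0, h1, rfl⟩
  rintro _ ⟨_, -, _, -, -, rfl⟩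
  exact Finset.sum_nonneg fun _ _ => hδ _ _

theorem exists_chain_lt {x y : S} {L : ℝ} (hL : chainInf δ x y < L) :
    ∃ N : ℕ, 1 ≤ N ∧ ∃ γ : ℕ → S, γ 0 = x ∧ γ N = y ∧
      ∑ n ∈ Finset.range N, δ (γ n) (γ (n + 1)) < L := by
  obtain ⟨_, ⟨N, hN, γ, h0, h1, rfl⟩, h⟩ := exists_lt_of_csInf_lt
    (by exact ⟨_, exists_link_chain δ x y⟩) hL
  exact ⟨N, hN, γ, h0, h1, h⟩

theorem chainInf_le_link (hδ : ∀ x y, 0 ≤ δ x y) (x y : S) : chainInf δ x y ≤ δ x y := by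
  obtain ⟨N, hN, γ, h0, h1, h⟩ := exists_link_chain δ x y
  exact (chainInf_le hδ hN h0 h1).trans h.ge

/-- A function obeying the triangle inequality telescopes along chains; this transfers the norm
bound from links to chains. -/
theorem le_chainInf {f : S → S → ℝ} (hf0 : ∀ x, f x x ≤ 0)
    (hf : ∀ x y z, f x z ≤ f x y + f y z) (hfδ : ∀ x y, f x y ≤ δ x y) (x y : S) :
    f x y ≤ chainInf δ x y := by
  refine le_csInf ⟨_, exists_link_chain δ x y⟩ ?_
  rintro _ ⟨N, -, γ, rfl, rfl, rfl⟩
  induction N with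
  | zero => simpa using hf0 _
  | succ N ih =>
    rw [Finset.sum_range_succ]
    exact (hf _ (γ N) _).trans (add_le_add ih (hfδ _ _))

theorem chainInf_comm_le (hδ : ∀ x y, 0 ≤ δ x y) (hs : ∀ x y, δ x y = δ y x) (x y : S) :
    chainInf δ y x ≤ chainInf δ x y := by
  refine le_of_forall_gt_imp_ge_of_dense fun L hL => ?_
  obtain ⟨N, hN, γ, rfl, rfl, h⟩ := exists_chain_lt hL
  refine (chainInf_le hδ hN (γ := fun n => γ (N - n)) (by simp) (by simp)).trans (le_trans ?_ h.le)
  rw [← Finset.sum_range_reflect]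
  refine (Finset.sum_congr rfl fun n hn => ?_).le
  rw [Finset.mem_range] at hn
  rw [hs]
  congr 2 <;> omega

theorem chainInf_triangle (hδ : ∀ x y, 0 ≤ δ x y) (x y z : S) :
    chainInf δ x z ≤ chainInf δ x y + chainInf δ y z := by
  refine le_of_forall_pos_le_add fun ε hε => ?_
  obtain ⟨N, hN, α, rfl, hα, h₁⟩ :=
    exists_chain_lt (show chainInf δ x y < chainInf δ x y + ε / 2 by linarith)
  obtain ⟨M, hM, β, rfl, rfl, h₂⟩ :=
    exists_chain_lt (show chainInf δ y z < chainInf δ y z + ε / 2 by linarith)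
  let γ : ℕ → S := fun n => if n ≤ N then α n else β (n - N)
  have hγ : ∀ n, γ (N + n) = β n := by
    intro n
    rcases Nat.eq_zero_or_pos n with rfl | hn
    · simp [γ, hα]
    · have : ¬ N + n ≤ N := by omega
      simp [γ, this]
  have h := chainInf_le hδ (hN.trans (Nat.le_add_right N M)) (γ := γ)
    (show γ 0 = α 0 by simp [γ]) (hγ M)
  rw [Finset.sum_range_add] at h
  have e₁ : ∑ n ∈ Finset.range N, δ (γ n) (γ (n + 1)) =
      ∑ n ∈ Finset.range N, δ (α n) (α (n + 1)) := by
    refine Finset.sum_congr rfl fun n hn => ?_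
    rw [Finset.mem_range] at hn
    simp [γ, hn.le, Nat.succ_le_iff.2 hn]
  have e₂ : ∑ n ∈ Finset.range M, δ (γ (N + n)) (γ (N + n + 1)) =
      ∑ n ∈ Finset.range M, δ (β n) (β (n + 1)) := by
    refine Finset.sum_congr rfl fun n _ => ?_
    rw [hγ, add_assoc, hγ]
  rw [e₁, e₂] at h
  linarith

/-- If links can be realized by Lipschitz curves, so can the infimum over chains. -/
theorem exists_lipschitz_curve_of_chainInf_lt [MetricSpace S] (hδ : ∀ x y, 0 ≤ δ x y)
    (h : ∀ x y L, δ x y < L → ∃ γ : ℝ → S, γ 0 = x ∧ γ 1 = y ∧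
      ∀ s ∈ Set.Icc (0 : ℝ) 1, ∀ t ∈ Set.Icc (0 : ℝ) 1, dist (γ s) (γ t) ≤ |s - t| * L)
    {x y : S} {L : ℝ} (hL : chainInf δ x y < L) : ∃ γ : ℝ → S, γ 0 = x ∧ γ 1 = y ∧
      ∀ s ∈ Set.Icc (0 : ℝ) 1, ∀ t ∈ Set.Icc (0 : ℝ) 1, dist (γ s) (γ t) ≤ |s - t| * L := by
  obtain ⟨N, hN, α, rfl, rfl, hα⟩ := exists_chain_lt hL
  clear hL
  induction N, hN using Nat.le_induction generalizing L with
  | base => exact h _ _ _ (by simpa using hα)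
  | succ N hN ih =>
    rw [Finset.sum_range_succ] at hα
    have hs : 0 ≤ ∑ n ∈ Finset.range N, δ (α n) (α (n + 1)) := Finset.sum_nonneg fun _ _ => hδ _ _
    have hl := hδ (α N) (α (N + 1))
    set s := ∑ n ∈ Finset.range N, δ (α n) (α (n + 1))
    set l := δ (α N) (α (N + 1))
    -- The slack `L - s - l` is shared equally, so both constants are positive and strictly exceed
    -- the costs.
    have := exists_lipschitz_curve_trans (L := s + (L - s - l) / 2) (M := l + (L - s - l) / 2)
      (by linarith) (by linarith) (ih (by linarith)) (h (α N) (α (N + 1)) _ (by linarith))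
    rwa [show s + (L - s - l) / 2 + (l + (L - s - l) / 2) = L by ring] at this

end Chain

/-! ### The folded Wasserstein distance -/

variable {H : Type*} [NormedAddCommGroup H] [InnerProductSpace ℂ H]
  {d : pureStates H → pureStates H → ℝ} {p : ℝ}

theorem foldedWasserstein_le_foldedKantorovich (hd : IsDistance d) (ρ σ : densityMatrices H) :
    foldedWasserstein d p ρ σ ≤ foldedKantorovich d p ρ σ :=
  chainInf_le_link (foldedKantorovich_nonneg hd) ρ σ

variable [FiniteDimensional ℂ H]

theorem continuous_of_topology_eq (N : Seminorm ℂ (H →L[ℂ] H)) (hN : ∀ A, N A = 0 → A = 0)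
    (hd : IsDistance d) (hd_top : hd.topology = (naturalTopology N hN).induced Subtype.val) :
    Continuous fun z : pureStates H × pureStates H => d z.1 z.2 := by
  have h := @continuous_dist _ hd.toMetricSpace.toPseudoMetricSpace
  have e : hd.topology = instTopologicalSpaceSubtype := by
    rw [hd_top, naturalTopology_eq]
    rfl
  rw [← e]
  exact h

theorem norm_sub_le_foldedWasserstein (N : Seminorm ℂ (H →L[ℂ] H)) (hd : IsDistance d)
    (hdc : Continuous fun z : pureStates H × pureStates H => d z.1 z.2)
    (hd_norm : ∀ P Q : pureStates H, N (P.1 - Q.1) ≤ d P Q) (hp : 1 ≤ p)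
    (ρ σ : densityMatrices H) : N (ρ.1 - σ.1) ≤ foldedWasserstein d p ρ σ := by
  refine le_chainInf (f := fun ρ σ : densityMatrices H => N (ρ.1 - σ.1)) (fun ρ => by simp)
    (fun ρ σ τ => ?_) (norm_sub_le_foldedKantorovich N hd hdc hd_norm hp) ρ σ
  have h := map_add_le_add N (ρ.1 - σ.1) (σ.1 - τ.1)
  rwa [sub_add_sub_cancel] at h

theorem isDistance_foldedWasserstein (N : Seminorm ℂ (H →L[ℂ] H)) (hN : ∀ A, N A = 0 → A = 0)
    (hd : IsDistance d) (hdc : Continuous fun z : pureStates H × pureStates H => d z.1 z.2)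
    (hd_norm : ∀ P Q : pureStates H, N (P.1 - Q.1) ≤ d P Q) (hp : 1 ≤ p) :
    IsDistance (foldedWasserstein d p) where
  eq_zero_iff ρ σ := by
    have hge := norm_sub_le_foldedWasserstein N hd hdc hd_norm hp ρ σ
    refine ⟨fun h => Subtype.ext (sub_eq_zero.1 (hN _ (le_antisymm (h ▸ hge) (apply_nonneg N _)))),
      ?_⟩
    rintro rfl
    refine le_antisymm ((foldedWasserstein_le_foldedKantorovich hd _ _).trans_eq
      (foldedKantorovich_self hd hdc hp ρ)) ((apply_nonneg N _).trans hge)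
  symm ρ σ :=
    have hs := foldedKantorovich_comm hd hdc hp
    le_antisymm (chainInf_comm_le (foldedKantorovich_nonneg hd) hs σ ρ)
      (chainInf_comm_le (foldedKantorovich_nonneg hd) hs ρ σ)
  triangle := chainInf_triangle (foldedKantorovich_nonneg hd)

theorem continuous_of_dist_le {K S : Type*} [TopologicalSpace K] [MetricSpace S] {f : K → S}
    (h : ∀ k₀, ∃ B : K → ℝ, Continuous B ∧ B k₀ = 0 ∧ ∀ k, dist (f k) (f k₀) ≤ B k) :
    Continuous f := by
  rw [continuous_iff_continuousAt]
  intro k₀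
  obtain ⟨B, hB, hB0, hle⟩ := h k₀
  rw [ContinuousAt, tendsto_iff_dist_tendsto_zero]
  exact squeeze_zero (fun _ => dist_nonneg) hle (hB0 ▸ hB.tendsto k₀)

/-- Both metrics are arguments, so that the folded distance and `N` can be inserted in place of the
ambient structures. -/
theorem continuous_of_dist_le_dist {X Y : Type*} [MetricSpace X] [MetricSpace Y] {f : X → Y}
    (h : ∀ x y, dist (f x) (f y) ≤ dist x y) : Continuous f :=
  (LipschitzWith.mk_one h).continuous

theorem polishSpace_and_completeSpace_of_compactSpace (S : Type*) [MetricSpace S]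
    [CompactSpace S] : PolishSpace S ∧ CompleteSpace S :=
  ⟨inferInstance, inferInstance⟩

theorem topology_foldedWasserstein (N : Seminorm ℂ (H →L[ℂ] H)) (hN : ∀ A, N A = 0 → A = 0)
    (hd : IsDistance d) (hdc : Continuous fun z : pureStates H × pureStates H => d z.1 z.2)
    (hd_norm : ∀ P Q : pureStates H, N (P.1 - Q.1) ≤ d P Q) (hp : 1 ≤ p)
    (hD : IsDistance (foldedWasserstein d p)) :
    hD.topology = (instTopologicalSpaceSubtype : TopologicalSpace (densityMatrices H)) := by
  apply le_antisymm
  · have h : @Continuous _ _ hD.topology (naturalTopology N hN)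
        (Subtype.val : densityMatrices H → H →L[ℂ] H) := by
      exact @continuous_of_dist_le_dist _ _ hD.toMetricSpace
        (isDistance_of_norm N hN).toMetricSpace _
        (norm_sub_le_foldedWasserstein N hd hdc hd_norm hp)
    rw [naturalTopology_eq] at h
    exact continuous_iff_le_induced.1 h
  -- A continuous surjection from a compact space to a Hausdorff space is a quotient map, so it
  -- suffices that mixing is continuous for the folded distance.
  · have hquot := Topology.IsQuotientMap.of_surjective_continuous
      (surjective_mixture (H := H)) continuous_mixture
    refine hquot.eq_coinduced.le.trans (continuous_iff_coinduced_le.1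
      (@continuous_of_dist_le _ _ _ hD.toMetricSpace _ ?_))
    rintro ⟨w₀, P₀⟩
    obtain ⟨C, hC⟩ : ∃ C, ∀ P Q, d P Q ^ p ≤ C := by
      obtain ⟨C, hC⟩ := (isCompact_range (continuous_cost hdc hp)).bddAbove
      exact ⟨C, fun P Q => hC ⟨(P, Q), rfl⟩⟩
    -- The coupling bound as a function of the mixture; at `(w₀, P₀)` the common mass is `1` and all
    -- distances vanish.
    let B : stdSimplex ℝ (Fin (Module.finrank ℂ H)) × (Fin (Module.finrank ℂ H) → pureStates H) →
      ℝ := fun q => (∑ i, min (q.1.1 i) (w₀.1 i) * d (q.2 i) (P₀ i) ^ p +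
        (1 - ∑ i, min (q.1.1 i) (w₀.1 i)) * C) ^ (1 / p)
    have hw : ∀ i, Continuous fun q : stdSimplex ℝ (Fin (Module.finrank ℂ H)) ×
        (Fin (Module.finrank ℂ H) → pureStates H) => min (q.1.1 i) (w₀.1 i) := fun i =>
      ((continuous_apply i).comp (continuous_subtype_val.comp continuous_fst)).min continuous_const
    have hP : ∀ i, Continuous fun q : stdSimplex ℝ (Fin (Module.finrank ℂ H)) ×
        (Fin (Module.finrank ℂ H) → pureStates H) => d (q.2 i) (P₀ i) ^ p := fun i =>
      (continuous_cost hdc hp).comp' (f := fun q : stdSimplex ℝ (Fin (Module.finrank ℂ H)) ×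
        (Fin (Module.finrank ℂ H) → pureStates H) => (q.2 i, P₀ i))
        (((continuous_apply i).comp continuous_snd).prodMk continuous_const)
    have hB : Continuous B := by
      refine Continuous.rpow_const ?_ fun _ => Or.inr (by positivity)
      exact (continuous_finsetSum _ fun i _ => (hw i).mul (hP i)).add
        ((continuous_const.sub (continuous_finsetSum _ fun i _ => hw i)).mul continuous_const)
    have hB0 : B (w₀, P₀) = 0 := by
      have h0 : ∀ P, d P P = 0 := fun P => (hd.eq_zero_iff P P).2 rfl
      have hp0 : p ≠ 0 := by linarith
      have hw1 : ∑ i, w₀.1 i = 1 := w₀.2.2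
      simp [B, h0, Real.zero_rpow, hp0, hw1]
    refine ⟨B, hB, hB0, fun q => ?_⟩
    exact (foldedWasserstein_le_foldedKantorovich hd _ _).trans
      (foldedKantorovich_mixture_mixture_le hd hdc hp hC q.1 w₀ q.2 P₀)

/-- If pure states are joined by geodesics, a finite plan moved along them is a Lipschitz curve of
density matrices. -/
theorem exists_lipschitz_curve_of_foldedKantorovich_lt (hd : IsDistance d)
    (hdc : Continuous fun z : pureStates H × pureStates H => d z.1 z.2) (hp : 1 ≤ p)
    (hgeo : IsGeodesic d) {ρ σ : densityMatrices H} {L : ℝ}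
    (hL : foldedKantorovich d p ρ σ < L) :
    ∃ γ : ℝ → densityMatrices H, γ 0 = ρ ∧ γ 1 = σ ∧
      ∀ s ∈ Set.Icc (0 : ℝ) 1, ∀ t ∈ Set.Icc (0 : ℝ) 1,
        foldedWasserstein d p (γ s) (γ t) ≤ |s - t| * L := by
  obtain ⟨ι, _, w, P, Q, rfl, rfl, h⟩ := exists_finite_plan hd hdc hp hL
  choose G hG0 hG1 hG using fun i => hgeo (P i) (Q i)
  -- The weights stay fixed while the atoms move; pairing `G i s` with `G i t` scales the plan's
  -- cost by `|s - t|`.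
  refine ⟨fun s => mixture w fun i => G i s, by simp [hG0], by simp [hG1], fun s hs t ht => ?_⟩
  refine (foldedWasserstein_le_foldedKantorovich hd _ _).trans
    ((foldedKantorovich_mixture_le hd hdc hp w _ _).trans ?_)
  have hp0 : p ≠ 0 := by linarith
  have e : ∑ i, w.1 i * d (G i s) (G i t) ^ p =
      |s - t| ^ p * ∑ i, w.1 i * d (P i) (Q i) ^ p := by
    rw [Finset.mul_sum]
    refine Finset.sum_congr rfl fun i _ => ?_
    rw [hG i s hs t ht, Real.mul_rpow (abs_nonneg _) (hd.nonneg _ _)]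
    ring
  rw [e, Real.mul_rpow (by positivity) (Finset.sum_nonneg fun i _ => mul_nonneg (w.2.1 i)
    (Real.rpow_nonneg (hd.nonneg _ _) _)), one_div, Real.rpow_rpow_inv (abs_nonneg _) hp0]
  rw [one_div] at h
  gcongr

end

end FoldedWasserstein

open FoldedWasserstein in
theorem theorem3p3 {H : Type*} [NormedAddCommGroup H] [InnerProductSpace ℂ H]
    [FiniteDimensional ℂ H]
    (N : Seminorm ℂ (H →L[ℂ] H)) (hN : ∀ A, N A = 0 → A = 0)
    (d : pureStates H → pureStates H → ℝ) (hd : IsDistance d)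
    (hd_top : hd.topology = (naturalTopology N hN).induced Subtype.val)
    (hd_norm : ∀ P Q : pureStates H, N (P.1 - Q.1) ≤ d P Q)
    (p : ℝ) (hp : 1 ≤ p) :
    (∃ hD : IsDistance (foldedWasserstein d p),
      hD.topology = (naturalTopology N hN).induced Subtype.val ∧
      @CompactSpace (densityMatrices H) hD.topology ∧
      @PolishSpace (densityMatrices H) hD.topology ∧
      @CompleteSpace (densityMatrices H) hD.toMetricSpace.toUniformSpace) ∧
    (IsGeodesic d → 1 < p → IsGeodesic (foldedWasserstein d p)) ∧
    (∀ ρ σ : densityMatrices H, N (ρ.1 - σ.1) ≤ foldedWasserstein d p ρ σ) ∧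
    (∀ P Q : pureStates H, foldedWasserstein d p (toDensity P) (toDensity Q) ≤ d P Q) ∧
    ((∀ P Q : pureStates H, d P Q = N (P.1 - Q.1)) →
      ∀ P Q : pureStates H, foldedWasserstein d p (toDensity P) (toDensity Q) = d P Q) := by
  have hdc := continuous_of_topology_eq N hN hd hd_top
  have hD := isDistance_foldedWasserstein N hN hd hdc hd_norm hp
  have htop := topology_foldedWasserstein N hN hd hdc hd_norm hp hD
  have hcompact : @CompactSpace (densityMatrices H) hD.topology := by
    rw [htop]
    infer_instance
  have hle : ∀ P Q : pureStates H,
      foldedWasserstein d p (toDensity P) (toDensity Q) ≤ d P Q := fun P Q =>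
    (foldedWasserstein_le_foldedKantorovich hd _ _).trans
      (foldedKantorovich_toDensity_le hd hdc hp P Q)
  have hpc := @polishSpace_and_completeSpace_of_compactSpace _ hD.toMetricSpace hcompact
  refine ⟨⟨hD, ?_, hcompact, hpc.1, hpc.2⟩, ?_, norm_sub_le_foldedWasserstein N hd hdc hd_norm hp,
    hle, fun heq P Q => le_antisymm (hle P Q) ?_⟩
  · rw [htop, naturalTopology_eq]
    rfl
  · intro hgeo _ ρ σ
    -- From here `dist` on density matrices is the folded distance, for which `hcompact` gives
    -- compactness.
    let _ := hD.toMetricSpace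
    exact exists_geodesic_of_approx ρ σ fun L hL =>
      exists_lipschitz_curve_of_chainInf_lt (foldedKantorovich_nonneg hd)
        (fun _ _ _ h => exists_lipschitz_curve_of_foldedKantorovich_lt hd hdc hp hgeo h) hL
  · rw [heq]
    exact norm_sub_le_foldedWasserstein N hd hdc hd_norm hp (toDensity P) (toDensity Q)
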